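/- **Setting.** A virtual knot diagram is a diagram of one closed curve in the plane whose double points are classical or virtual crossings; its group is given by the Wirtinger presentation (virtual crossings are ignored). A *Coxeter quotient of rank $n$* of a diagram is a surjective homomorphism from its group onto a Coxeter group with $n$ generators (all weights $m(a,b)$, $a\neq b$, at least $2$, possibly $\infty$) that sends every meridian to a reflection, i.e. to a conjugate of a generator; the image of the meridian of a strand is the label of the strand. A twist region is a disk containing a two-strand braid; in a classical diagram all its crossings twist in the same direction. Let $D$ be a classical knot diagram in the plane, decomposed into twist regions, which gives rise to a Coxeter quotient of rank $n$ in one of the following ways. * (*Twisted diagrams.*) $D$ is the boundary of a checkerboard surface consisting of disks and twisted bands, one band for every twist region, such that every band has at least two half twists, and the plane dual $\Gamma^*$ of the graph $\Gamma$ with the disks as vertices and the bands as edges is a simple graph with $n$ vertices. Here the generators are the vertices of $\Gamma^*$, every twist region corresponds to the two distinct generators given by the faces of $\Gamma$ on its two sides, and no twist region corresponds to a single generator. * (*Other diagrams, in particular those of arborescent knots.*) A Coxeter quotient of $D$ of rank $n$ is given. A twist region corresponds to a single generator if all its strands have the same label. It corresponds to the two distinct generators $a,b$ if its two ends on the left are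 labelled $a$, its two ends on the right are labelled $b$, and, in case its number of crossings is even, the weight $m(a,b)$ is even. **Theorem 1.2.** Let $D'$ be obtained from $D$ by any combination of the following local operations, each crossing of $D$ being used at most once: 1. replacing any number of classical crossings by virtual crossings in twist regions corresponding to a single generator; 2. replacing any number of classical crossings by virtual crossings in twist regions that correspond to two distinct generators and have an even number of crossings; 3. any number of flank-switch moves anywhere (a classical crossing is switched and a virtual crossing is put before and behind it, along the twist region); 4. any number of flank moves in any twist region (a virtual crossing is put before and behind a classical crossing, which is not switched), balanced by added classical crossings of the same twist region, twisting in its direction: two are added for every crossing that is replaced by a flanked one (equivalently, a flanked crossing is inserted together with one classical crossing). Then $D'$ is a virtual knot diagram that has a Coxeter quotient of rank $n$. -/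

import Mathlib

namespace VirtualKnot

/-- A crossing of two strands inside a vertical twist region, both strands read upwards.
`pos`: classical, the strand from bottom left to top right passes over;
`neg`: classical, the strand from bottom right to top left passes over;
`virt`: a virtual crossing. -/
inductive Crossing where
  | pos : Crossing
  | neg : Crossing
  | virt : Crossing

/-- The crossing with over- and understrand exchanged. -/
def Crossing.switch : Crossing → Crossing
  | .pos => .neg
  | .neg => .pos
  | .virt => .virt

/-- A virtual link diagram decomposed into twist regions.  Every twist region `r : R` is a disk with
four ends, numbered counterclockwise `0` = bottom left, `1` = bottom right, `2` = top right,
`3` = top left, and contains the two-strand (virtual) braid `word r`, whose crossings are listed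
from bottom to top.  The involution `glue` says which ends are joined by an arc of the diagram
outside of the disks.  Every virtual link diagram can be written in this way (a single crossing is
a twist region with a word of length one). -/
structure Diagram (R : Type*) where
  word : R → List Crossing
  glue : Equiv.Perm (R × Fin 4)
  glue_glue : ∀ e, glue (glue e) = e
  glue_ne : ∀ e, glue e ≠ e

namespace Diagram

variable {R : Type*}

/-- The segments into which the crossings cut the strands inside the twist regions: a twist region,
a level (level `i` lies between the crossings `i - 1` and `i`), and a side (`false` = left,
`true` = right).  The segments at the lowest and at the highest level contain the four ends. -/
abbrev Segment (D : Diagram R) : Type _ :=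
  (r : R) × (Fin ((D.word r).length + 1) × Bool)

/-- The segment containing a given end of a twist region. -/
def endSegment (D : Diagram R) (e : R × Fin 4) : D.Segment :=
  match e with
  | (r, 0) => ⟨r, 0, false⟩
  | (r, 1) => ⟨r, 0, true⟩
  | (r, 2) => ⟨r, Fin.last _, true⟩
  | (r, 3) => ⟨r, Fin.last _, false⟩

/-- Two segments that follow each other on a component of the diagram. -/
inductive Follows (D : Diagram R) : D.Segment → D.Segment → Prop
  | cross (r : R) (i : Fin (D.word r).length) (side : Bool) :
      Follows D ⟨r, i.castSucc, side⟩ ⟨r, i.succ, !side⟩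
  | glue (e : R × Fin 4) : Follows D (D.endSegment e) (D.endSegment (D.glue e))

/-- The diagram has exactly one component. -/
def IsKnot (D : Diagram R) : Prop :=
  Nonempty D.Segment ∧ ∀ s t : D.Segment, Relation.EqvGen D.Follows s t

/-- Rotation of the ends of a twist region by one step counterclockwise. -/
def rotate (R : Type*) : Equiv.Perm (R × Fin 4) :=
  Equiv.prodCongr (Equiv.refl R) (Equiv.addRight 1)

/-- The diagram lies in the plane: the four-valent map whose vertices are the twist regions has
Euler characteristic two.  It has `Nat.card R` vertices and `2 * Nat.card R` edges, and its faces
are the orbits of the permutation "cross the arc, then turn to the next end".  (For a diagram with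
one component the map is connected, and this is planarity.) -/
def IsPlanar (D : Diagram R) : Prop :=
  Nat.card (Quotient (Equiv.Perm.SameCycle.setoid (D.glue.trans (rotate R)))) = Nat.card R + 2

/-- No virtual crossings, and all crossings of a twist region twist in the same direction. -/
def IsClassical (D : Diagram R) : Prop :=
  ∀ r, ∃ c k, c ≠ Crossing.virt ∧ D.word r = List.replicate k c

/-- The meridian of a segment oriented upwards. -/
def upMeridian (D : Diagram R) (s : D.Segment) : FreeGroup D.Segment := FreeGroup.of s

/-- The meridian at an end of a twist region, for the strand oriented into the twist region. -/
def inMeridian (D : Diagram R) (e : R × Fin 4) : FreeGroup D.Segment :=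
  if e.2 = 0 ∨ e.2 = 1 then D.upMeridian (D.endSegment e) else (D.upMeridian (D.endSegment e))⁻¹

/-- The Wirtinger relations.  At a classical crossing of sign `ε`, the outgoing understrand is
`β ^ ε * a * β ^ (-ε)`, where `a` is the incoming understrand and `β` the overstrand; this is
written for both strands oriented upwards, and reversing a strand (that is, inverting its meridian)
gives an equivalent relation.  Strands pass unchanged through a virtual crossing.  The overstrand is
unchanged too. -/
inductive Wirtinger (D : Diagram R) : FreeGroup D.Segment → FreeGroup D.Segment → Prop
  | pos_over (r : R) (i : Fin (D.word r).length) (h : (D.word r).get i = .pos) :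
      Wirtinger D (D.upMeridian ⟨r, i.succ, true⟩) (D.upMeridian ⟨r, i.castSucc, false⟩)
  | pos_under (r : R) (i : Fin (D.word r).length) (h : (D.word r).get i = .pos) :
      Wirtinger D (D.upMeridian ⟨r, i.succ, false⟩)
        (D.upMeridian ⟨r, i.castSucc, false⟩ * D.upMeridian ⟨r, i.castSucc, true⟩ *
          (D.upMeridian ⟨r, i.castSucc, false⟩)⁻¹)
  | neg_over (r : R) (i : Fin (D.word r).length) (h : (D.word r).get i = .neg) :
      Wirtinger D (D.upMeridian ⟨r, i.succ, false⟩) (D.upMeridian ⟨r, i.castSucc, true⟩)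
  | neg_under (r : R) (i : Fin (D.word r).length) (h : (D.word r).get i = .neg) :
      Wirtinger D (D.upMeridian ⟨r, i.succ, true⟩)
        ((D.upMeridian ⟨r, i.castSucc, true⟩)⁻¹ * D.upMeridian ⟨r, i.castSucc, false⟩ *
          D.upMeridian ⟨r, i.castSucc, true⟩)
  | virt (r : R) (i : Fin (D.word r).length) (side : Bool) (h : (D.word r).get i = .virt) :
      Wirtinger D (D.upMeridian ⟨r, i.succ, !side⟩) (D.upMeridian ⟨r, i.castSucc, side⟩)
  | glue (e : R × Fin 4) : Wirtinger D (D.inMeridian e) (D.inMeridian (D.glue e))⁻¹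

/-- The group of a virtual link diagram. -/
abbrev knotGroup (D : Diagram R) : Type _ :=
  PresentedGroup {g : FreeGroup D.Segment | ∃ a b, D.Wirtinger a b ∧ g = a * b⁻¹}

/-- The meridian of a segment, as an element of the group of the diagram. -/
def meridian (D : Diagram R) (s : D.Segment) : D.knotGroup := PresentedGroup.of s

/-- `f` is a Coxeter quotient: onto, and every meridian goes to a reflection.  (In a
`CoxeterMatrix`, entries off the diagonal are at least two, or `0` for "no relation"; the rank is
the size of the index set.) -/
def IsCoxeterQuotient (D : Diagram R) {n : ℕ} (M : CoxeterMatrix (Fin n))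
    (f : D.knotGroup →* M.Group) : Prop :=
  Function.Surjective f ∧ ∀ s, M.toCoxeterSystem.IsReflection (f (D.meridian s))

/-- The group of the diagram has a Coxeter quotient of rank `n`, meridians going to reflections. -/
def HasCoxeterQuotient (D : Diagram R) (n : ℕ) : Prop :=
  ∃ (M : CoxeterMatrix (Fin n)) (f : D.knotGroup →* M.Group), D.IsCoxeterQuotient M f

/-! ### Twisted diagrams -/

/-- Two ends on the boundary of the same region to the left or to the right of twist regions. -/
inductive SideStep (D : Diagram R) : R × Fin 4 → R × Fin 4 → Prop
  | left (r : R) : SideStep D (r, 0) (r, 3)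
  | right (r : R) : SideStep D (r, 1) (r, 2)
  | glue (e : R × Fin 4) : SideStep D e (D.glue e)

/-- For a checkerboard surface made of disks and of twisted bands running vertically through the
twist regions: the regions of the plane in the complement of the projection of the surface, i.e. the
faces of the plane graph `Γ` (disks as vertices, bands as edges), i.e. the vertices of its dual. -/
def Face (D : Diagram R) : Type _ := Quot D.SideStep

/-- The face to the left of a twist region. -/
def leftFace (D : Diagram R) (r : R) : D.Face := Quot.mk _ (r, 0)

/-- The face to the right of a twist region. -/
def rightFace (D : Diagram R) (r : R) : D.Face := Quot.mk _ (r, 1)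

/-- A twisted diagram.  `checkerboard`: the regions below and above the twist regions can be shaded
and those to the left and to the right left white; the shaded surface is then a union of disks and
bands, one band with `word r` half twists for every `r`.  `two_le`: every band has at least two half
twists, all in one direction.  `no_loop`, `no_parallel`: the dual graph is simple. -/
structure IsTwisted (D : Diagram R) : Prop where
  checkerboard : ∀ e, (D.glue e).2.val % 2 ≠ e.2.val % 2
  two_le : ∀ r, ∃ c k, c ≠ Crossing.virt ∧ 2 ≤ k ∧ D.word r = List.replicate k c
  no_loop : ∀ r, D.leftFace r ≠ D.rightFace r
  no_parallel : ∀ r r', s(D.leftFace r, D.rightFace r) = s(D.leftFace r', D.rightFace r') → r = r'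

/-! ### Twist regions and Coxeter generators -/

/-- Under the quotient `f`, the twist region corresponds to a single generator: both strands that
enter it (hence all strands in it) have the same label. -/
def IsSingle (D : Diagram R) {n : ℕ} {M : CoxeterMatrix (Fin n)} (f : D.knotGroup →* M.Group)
    (r : R) : Prop :=
  f (D.meridian (D.endSegment (r, 0))) = f (D.meridian (D.endSegment (r, 1)))

/-- Under the quotient `f`, the twist region corresponds to two distinct generators: both ends on
the left are labelled by one of them, both ends on the right by the other one, and if the number of
crossings is even then so is the Coxeter weight that belongs to it (an even number, or infinite,
encoded by `0`). -/
def IsDouble (D : Diagram R) {n : ℕ} {M : CoxeterMatrix (Fin n)} (f : D.knotGroup →* M.Group)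
    (r : R) : Prop :=
  ∃ a b : Fin n, a ≠ b ∧
    f (D.meridian (D.endSegment (r, 0))) = M.simple a ∧
    f (D.meridian (D.endSegment (r, 3))) = M.simple a ∧
    f (D.meridian (D.endSegment (r, 1))) = M.simple b ∧
    f (D.meridian (D.endSegment (r, 2))) = M.simple b ∧
    (Even (D.word r).length → Even (M a b))

/-- `D` gives rise to a Coxeter quotient of rank `n`, for which `single` and `double` are the sets of
twist regions corresponding to a single generator and to two distinct generators.
* `twisted`: twisted diagrams.  The generators are the faces, and every twist region corresponds to
  the two faces next to it.  Nothing is assumed about the group.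
* `labelled`: any other diagram (arborescent ones, for instance) that comes with a Coxeter
  quotient. -/
inductive GivesCoxeterQuotient (D : Diagram R) (n : ℕ) : Set R → Set R → Prop
  | twisted (h : D.IsTwisted) (hn : Nat.card D.Face = n) : GivesCoxeterQuotient D n ∅ Set.univ
  | labelled (M : CoxeterMatrix (Fin n)) (f : D.knotGroup →* M.Group)
      (hf : D.IsCoxeterQuotient M f) :
      GivesCoxeterQuotient D n {r | D.IsSingle f r} {r | D.IsDouble f r}

/-! ### The local operations -/

/-- `Moves c k w v f a`: from a twist region with `k` crossings `c` one obtains the word `w` by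
`v` virtualizations, any number of flank-switch moves, `f` flank moves, and by adding `a` crossings
`c`, where every original crossing takes part in at most one move.  A virtualization replaces a
classical crossing by a virtual one; a flank move puts a virtual crossing before and behind a
classical crossing; a flank-switch move does this and switches the classical crossing. -/
inductive Moves (c : Crossing) : ℕ → List Crossing → ℕ → ℕ → ℕ → Prop
  | nil : Moves c 0 [] 0 0 0
  | keep {k w v f a} : Moves c k w v f a → Moves c (k + 1) (c :: w) v f a
  | virtualize {k w v f a} : Moves c k w v f a → Moves c (k + 1) (.virt :: w) (v + 1) f a
  | flankSwitch {k w v f a} : Moves c k w v f a →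
      Moves c (k + 1) (.virt :: c.switch :: .virt :: w) v f a
  | flank {k w v f a} : Moves c k w v f a →
      Moves c (k + 1) (.virt :: c :: .virt :: w) v (f + 1) a
  | add {k w v f a} : Moves c k w v f a → Moves c k (c :: w) v f (a + 1)

/-- `D'` is obtained from `D` by any combination of the following operations: virtualizations in
twist regions in `single`; virtualizations in twist regions in `double` with an even number of
crossings; flank-switch moves in any twist region; flank moves in any twist region, balanced by
classical crossings that are added to the same twist region and twist in the same direction.
For labels of order two, a flanked crossing acts like the inverse of the crossing, so two crossings
have to be added for every crossing that is replaced by a flanked one.  (In other words: a flanked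
crossing is inserted together with one classical crossing.) -/
def ObtainedFrom (D' D : Diagram R) (single double : Set R) : Prop :=
  D'.glue = D.glue ∧
  ∀ r, ∃ (c : Crossing) (k v f a : ℕ), c ≠ .virt ∧ D.word r = List.replicate k c ∧
    Moves c k (D'.word r) v f a ∧ a = 2 * f ∧
    (v ≠ 0 → r ∈ single ∨ (r ∈ double ∧ Even k))

end Diagram

end VirtualKnot

/-! A quotient sending meridians to reflections is a labelling of the strands by reflections. Since
reflections are involutions, orientations are irrelevant. A braid word acts by a permutation
(`passWord`) on the pairs of labels at its bottom, so only the labels of the ends of the twist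
regions matter. A word may be replaced by any other word with the same effect on the given bottom
pair; the labels, and hence the quotient, survive.

For a classical crossing `c`, a flanked `c` acts as the inverse of `c` (`pass_flank`). So a
flank-switch move changes nothing, and two added crossings compensate a flank move
(`Moves.passWord_eq`). Virtualizations need more. If both labels agree, every crossing fixes the
pair. For two generators of even weight, pass to the Coxeter group in which all even and infinite
weights become `2` (`collapseHom`). The rank is unchanged and reflections go to reflections, but now
the two generators commute. Every crossing just swaps them, and only the parity of the word counts.

For a twisted diagram the quotient is constructed by labelling each end with its face and taking the
number of crossings as weight. In all cases the parity of each word and the gluing are preserved, so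
the result is still a planar knot diagram. -/

namespace VirtualKnot

open Function

/-! ### Braid action on pairs of reflections -/

/-- The reflections of the Coxeter group of `M`. -/
abbrev Reflection {B : Type*} (M : CoxeterMatrix B) : Type _ :=
  {t : M.Group // M.toCoxeterSystem.IsReflection t}

namespace Reflection

variable {B : Type*} {M : CoxeterMatrix B}

theorem mul_self (t : Reflection M) : (t : M.Group) * t = 1 := t.2.mul_self

theorem inv_eq (t : Reflection M) : (t : M.Group)⁻¹ = t := t.2.inv

/-- Conjugation of the reflection `u` by the reflection `t`. -/
def conj (t u : Reflection M) : Reflection M := ⟨t * u * (t : M.Group)⁻¹, u.2.conj t⟩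

theorem coe_conj (t u : Reflection M) : (conj t u : M.Group) = t * u * t := by
  simp [conj, inv_eq]

theorem conj_conj (t u : Reflection M) : conj t (conj t u) = u := by
  apply Subtype.ext
  rw [coe_conj, coe_conj, ← mul_assoc, ← mul_assoc, mul_self, one_mul, mul_assoc, mul_self, mul_one]

theorem conj_self (t : Reflection M) : conj t t = t := by
  apply Subtype.ext
  rw [coe_conj, mul_self, one_mul]

theorem conj_eq_of_commute {t u : Reflection M} (h : Commute (t : M.Group) u) :
    conj t u = u := by
  apply Subtype.ext
  rw [coe_conj, h.eq, mul_assoc, mul_self, mul_one]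

/-- The simple reflections. -/
def simple (M : CoxeterMatrix B) (i : B) : Reflection M :=
  ⟨M.simple i, M.toCoxeterSystem.isReflection_simple i⟩

theorem simple_mul_simple_pow (i j : B) : (M.simple i * M.simple j) ^ M i j = 1 :=
  M.toCoxeterSystem.simple_mul_simple_pow i j

end Reflection

open Reflection

section Pass

variable {B : Type*} {M : CoxeterMatrix B}

/-- Labels above a `pos` crossing, from those below. -/
def passPos (M : CoxeterMatrix B) : Equiv.Perm (Reflection M × Reflection M) where
  toFun p := (conj p.1 p.2, p.1)
  invFun p := (p.2, conj p.2 p.1)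
  left_inv p := by simp [conj_conj]
  right_inv p := by simp [conj_conj]

/-- Labels above a crossing, from those below. -/
def pass (M : CoxeterMatrix B) : Crossing → Equiv.Perm (Reflection M × Reflection M)
  | .pos => passPos M
  | .neg => (passPos M)⁻¹
  | .virt => Equiv.prodComm _ _

theorem pass_pos_apply (p : Reflection M × Reflection M) :
    pass M .pos p = (conj p.1 p.2, p.1) := rfl

theorem pass_neg_apply (p : Reflection M × Reflection M) :
    pass M .neg p = (p.2, conj p.2 p.1) := rfl

theorem pass_virt_apply (p : Reflection M × Reflection M) : pass M .virt p = (p.2, p.1) := rfl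

theorem pass_switch {c : Crossing} (hc : c ≠ .virt) : pass M c.switch = (pass M c)⁻¹ := by
  cases c <;> simp_all [Crossing.switch, pass]

/-- A flanked classical crossing acts like the inverse of the crossing. -/
theorem pass_flank {c : Crossing} (hc : c ≠ .virt) :
    pass M .virt * pass M c * pass M .virt = (pass M c)⁻¹ := by
  cases c
  · rfl
  · rw [pass, inv_inv]; rfl
  · exact absurd rfl hc

/-- The action of a braid word on the labels at its bottom. -/
def passWord (M : CoxeterMatrix B) (w : List Crossing) :
    Equiv.Perm (Reflection M × Reflection M) :=
  (w.map (pass M)).reverse.prod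

@[simp] theorem passWord_nil : passWord M [] = 1 := rfl

@[simp] theorem passWord_cons (c : Crossing) (w : List Crossing) :
    passWord M (c :: w) = passWord M w * pass M c := by
  simp [passWord]

theorem passWord_append (w w' : List Crossing) :
    passWord M (w ++ w') = passWord M w' * passWord M w := by
  simp [passWord]

theorem passWord_replicate (k : ℕ) (c : Crossing) :
    passWord M (List.replicate k c) = pass M c ^ k := by
  simp [passWord]

theorem passWord_take_succ (w : List Crossing) (i : Fin w.length) :
    passWord M (w.take (i + 1)) = pass M (w.get i) * passWord M (w.take i) := by
  rw [List.take_succ_eq_append_getElem i.2, passWord_append]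
  simp

/-- The product of the two labels is invariant under the crossing, so each step multiplies by the
same rotation `x * y` of the dihedral group generated by `x` and `y`. -/
theorem passPos_pow_apply (k : ℕ) (x y : Reflection M) :
    (((passPos M ^ k) (x, y)).1 : M.Group) = (x * y) ^ k * x ∧
      (((passPos M ^ k) (x, y)).2 : M.Group) = (x * y) ^ k * y := by
  induction k generalizing x y with
  | zero => simp
  | succ k ih =>
    rw [pow_succ, Equiv.Perm.mul_apply]
    have h : ((conj x y : Reflection M) : M.Group) * x = x * y := by
      rw [coe_conj, mul_assoc, mul_self, mul_one]
    obtain ⟨h₁, h₂⟩ := ih (conj x y) x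
    rw [h] at h₁ h₂
    constructor
    · rw [show passPos M (x, y) = (conj x y, x) from rfl, h₁, coe_conj, pow_succ]
      simp only [mul_assoc]
    · rw [show passPos M (x, y) = (conj x y, x) from rfl, h₂, pow_succ, mul_assoc, mul_assoc,
        mul_self, mul_one]

theorem pass_pow_apply_eq_self {c : Crossing} (hc : c ≠ .virt) {k : ℕ} {x y : Reflection M}
    (h : ((x : M.Group) * y) ^ k = 1) : (pass M c ^ k) (x, y) = (x, y) := by
  have hpos : (passPos M ^ k) (x, y) = (x, y) := by
    obtain ⟨h₁, h₂⟩ := passPos_pow_apply k x y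
    rw [h, one_mul] at h₁ h₂
    exact Prod.ext (Subtype.ext h₁) (Subtype.ext h₂)
  cases c
  · exact hpos
  · rw [pass, inv_pow, Equiv.Perm.inv_eq_iff_eq, hpos]
  · exact absurd rfl hc

theorem pass_apply_diag (c : Crossing) (x : Reflection M) : pass M c (x, x) = (x, x) := by
  cases c <;> simp [pass_pos_apply, pass_neg_apply, pass_virt_apply, conj_self]

theorem passWord_apply_diag (w : List Crossing) (x : Reflection M) :
    passWord M w (x, x) = (x, x) := by
  induction w with
  | nil => rfl
  | cons c w ih => rw [passWord_cons, Equiv.Perm.mul_apply, pass_apply_diag, ih]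

theorem pass_apply_of_commute (c : Crossing) {x y : Reflection M}
    (h : Commute (x : M.Group) y) : pass M c (x, y) = (y, x) := by
  cases c
  · rw [pass_pos_apply, conj_eq_of_commute h]
  · rw [pass_neg_apply, conj_eq_of_commute h.symm]
  · rfl

/-- Conjugation is trivial between commuting labels, so a classical crossing acts like a virtual
one. -/
theorem passWord_apply_of_commute (w : List Crossing) {x y : Reflection M}
    (h : Commute (x : M.Group) y) :
    passWord M w (x, y) = if Even w.length then (x, y) else (y, x) := by
  induction w generalizing x y with
  | nil => simp
  | cons c w ih =>
    rw [passWord_cons, Equiv.Perm.mul_apply, pass_apply_of_commute c h, ih h.symm]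
    by_cases hw : Even w.length <;> simp [hw, Nat.even_add_one]

/-- Inner labels lie in the subgroup generated by the bottom labels; hence the labels of the ends
alone generate the image. -/
theorem passWord_mem {S : Subgroup M.Group} (w : List Crossing) {x y : Reflection M}
    (hx : (x : M.Group) ∈ S) (hy : (y : M.Group) ∈ S) :
    ((passWord M w (x, y)).1 : M.Group) ∈ S ∧ ((passWord M w (x, y)).2 : M.Group) ∈ S := by
  induction w generalizing x y with
  | nil => exact ⟨hx, hy⟩
  | cons c w ih =>
    rw [passWord_cons, Equiv.Perm.mul_apply]
    cases c
    · exact ih (by rw [coe_conj]; exact S.mul_mem (S.mul_mem hx hy) hx) hx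
    · exact ih hy (by rw [coe_conj]; exact S.mul_mem (S.mul_mem hy hx) hy)
    · exact ih hy hx

end Pass

namespace Diagram

variable {R : Type*}

/-! ### Effect of the moves on a word -/

theorem Moves.length_eq {c : Crossing} {k v f a : ℕ} {w : List Crossing} (h : Moves c k w v f a) :
    ∃ m, w.length = k + a + 2 * m := by
  induction h with
  | nil => exact ⟨0, rfl⟩
  | keep _ ih | virtualize _ ih | add _ ih =>
    obtain ⟨m, hm⟩ := ih
    exact ⟨m, by rw [List.length_cons, hm]; omega⟩
  | flankSwitch _ ih | flank _ ih =>
    obtain ⟨m, hm⟩ := ih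
    exact ⟨m + 1, by simp only [List.length_cons, hm]; omega⟩

/-- A kept, added or flank-switched crossing contributes exponent `1`, a flanked one `-1`; the
latter is already counted as `1` in `k`, whence `- 2 * f`. -/
theorem Moves.passWord_eq {B : Type*} (M : CoxeterMatrix B) {c : Crossing} (hc : c ≠ .virt)
    {k v f a : ℕ} {w : List Crossing} (h : Moves c k w v f a) (hv : v = 0) :
    passWord M w = pass M c ^ ((k : ℤ) + a - 2 * f) := by
  induction h with
  | nil => simp
  | keep _ ih | add _ ih =>
    rw [passWord_cons, ih hv, ← zpow_add_one]
    congr 1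
    push_cast
    ring
  | virtualize _ _ => omega
  | flankSwitch _ ih =>
    have h : pass M .virt * (pass M c)⁻¹ * pass M .virt = pass M c := by
      rw [← pass_switch hc, pass_flank (by cases c <;> simp_all [Crossing.switch]),
        pass_switch hc, inv_inv]
    rw [passWord_cons, passWord_cons, passWord_cons, ih hv, mul_assoc, mul_assoc,
      ← mul_assoc (pass M .virt), pass_switch hc, h, ← zpow_add_one]
    congr 1
    push_cast
    ring
  | flank _ ih =>
    rw [passWord_cons, passWord_cons, passWord_cons, ih hv, mul_assoc, mul_assoc,
      ← mul_assoc (pass M .virt), pass_flank hc, ← zpow_sub_one]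
    congr 1
    push_cast
    ring

/-! ### The number of components -/

/-- Crossings of every kind exchange the two sides, so following a strand down to the bottom only
involves the parity of the level. -/
theorem eqvGen_bottom (D : Diagram R) (r : R) (i : ℕ) (hi : i < (D.word r).length + 1)
    (side : Bool) :
    Relation.EqvGen D.Follows ⟨r, ⟨i, hi⟩, side⟩ ⟨r, 0, side ^^ decide (Odd i)⟩ := by
  induction i generalizing side with
  | zero => simpa using Relation.EqvGen.refl _
  | succ i ih =>
    have h₁ := ih (by omega) (!side)
    have h₂ := Follows.cross (D := D) r ⟨i, by omega⟩ (!side)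
    rw [Bool.not_not] at h₂
    refine .trans _ _ _ (.symm _ _ (.rel _ _ h₂)) ?_
    have h₃ : (side ^^ decide (Odd (i + 1))) = (!side ^^ decide (Odd i)) := by
      by_cases h : Odd i <;> simp [h, Nat.odd_add_one]
    rw [h₃]
    exact h₁

/-- How a twist region connects its ends depends only on the parity of its word. -/
theorem isKnot_of_parity {D D' : Diagram R} (hD : D.IsKnot) (hglue : D'.glue = D.glue)
    (hpar : ∀ r, Odd (D'.word r).length ↔ Odd (D.word r).length) : D'.IsKnot := by
  obtain ⟨⟨s₀⟩, hconn⟩ := hD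
  refine ⟨⟨⟨s₀.1, 0, false⟩⟩, ?_⟩
  -- `φ` slides a segment of `D` down its strand to the bottom of the twist region, read in `D'`.
  let φ : D.Segment → D'.Segment := fun s => ⟨s.1, 0, s.2.2 ^^ decide (Odd s.2.1.val)⟩
  have hend : ∀ e, Relation.EqvGen D'.Follows (φ (D.endSegment e)) (D'.endSegment e) := by
    rintro ⟨r, i⟩
    refine .symm _ _ ?_
    fin_cases i
    · exact .refl _
    · exact .refl _
    -- At the top ends `φ` uses the parity of `D.word r`, the strand of `D'` that of `D'.word r`.
    · have h := D'.eqvGen_bottom r (D'.word r).length (by omega) true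
      simp only [hpar] at h
      exact h
    · have h := D'.eqvGen_bottom r (D'.word r).length (by omega) false
      simp only [hpar] at h
      exact h
  have hφ : ∀ s t, Relation.EqvGen D.Follows s t → Relation.EqvGen D'.Follows (φ s) (φ t) := by
    intro s t h
    induction h with
    | rel s t h =>
      cases h with
      | cross r i side =>
        have : φ ⟨r, i.castSucc, side⟩ = φ ⟨r, i.succ, !side⟩ := by
          by_cases h : Odd i.val <;> simp [φ, h, Nat.odd_add_one]
        rw [this]
        exact .refl _
      | glue e =>
        refine .trans _ _ _ (hend e) (.trans _ _ _ (.rel _ _ (.glue e)) ?_)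
        rw [hglue]
        exact .symm _ _ (hend _)
    | refl s => exact .refl _
    | symm s t _ ih => exact .symm _ _ ih
    | trans s t u _ _ ih₁ ih₂ => exact .trans _ _ _ ih₁ ih₂
  have hsurj : ∀ s : D'.Segment, ∃ t, Relation.EqvGen D'.Follows s (φ t) := by
    rintro ⟨r, ⟨i, hi⟩, side⟩
    refine ⟨⟨r, 0, side ^^ decide (Odd i)⟩, ?_⟩
    have h := D'.eqvGen_bottom r i hi side
    simpa [φ] using h
  intro s t
  obtain ⟨s', hs⟩ := hsurj s
  obtain ⟨t', ht⟩ := hsurj t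
  exact .trans _ _ _ hs (.trans _ _ _ (hφ _ _ (hconn s' t')) (.symm _ _ ht))

/-! ### Labellings of the ends by reflections -/

/-- Labels of the ends of the twist regions that come from a Coxeter quotient. -/
structure IsEndLabelling (D : Diagram R) {B : Type*} (M : CoxeterMatrix B)
    (L : R × Fin 4 → Reflection M) : Prop where
  glue : ∀ e, L (D.glue e) = L e
  passWord : ∀ r, passWord M (D.word r) (L (r, 0), L (r, 1)) = (L (r, 3), L (r, 2))
  generates : Subgroup.closure (Set.range fun e => (L e : M.Group)) = ⊤

/-- The label of a segment, determined by the labels at the bottom of its twist region. -/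
def segmentLabel (D : Diagram R) {B : Type*} {M : CoxeterMatrix B} (L : R × Fin 4 → Reflection M)
    (s : D.Segment) : Reflection M :=
  let p := VirtualKnot.passWord M ((D.word s.1).take s.2.1) (L (s.1, 0), L (s.1, 1))
  if s.2.2 then p.2 else p.1

theorem segmentLabel_pair (D : Diagram R) {B : Type*} {M : CoxeterMatrix B}
    (L : R × Fin 4 → Reflection M) (r : R) (i : Fin (D.word r).length) :
    (D.segmentLabel L ⟨r, i.succ, false⟩, D.segmentLabel L ⟨r, i.succ, true⟩) =
      pass M ((D.word r).get i)
        (D.segmentLabel L ⟨r, i.castSucc, false⟩, D.segmentLabel L ⟨r, i.castSucc, true⟩) := by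
  simp [segmentLabel, passWord_take_succ]

theorem IsEndLabelling.segmentLabel_endSegment {D : Diagram R} {B : Type*} {M : CoxeterMatrix B}
    {L : R × Fin 4 → Reflection M} (h : D.IsEndLabelling M L) (e : R × Fin 4) :
    D.segmentLabel L (D.endSegment e) = L e := by
  obtain ⟨r, i⟩ := e
  have hr := h.passWord r
  fin_cases i <;> simp [segmentLabel, endSegment, hr]

/-- A reflection is its own inverse, so the inversion at the top ends disappears and a gluing
relation just equates two labels. -/
theorem lift_inMeridian (D : Diagram R) {B : Type*} {M : CoxeterMatrix B}
    (φ : FreeGroup D.Segment →* M.Group) (e : R × Fin 4)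
    (h : M.toCoxeterSystem.IsReflection (φ (.of (D.endSegment e)))) :
    φ (D.inMeridian e) = φ (.of (D.endSegment e)) := by
  unfold inMeridian upMeridian
  split_ifs
  · rfl
  · rw [map_inv, h.inv]

theorem IsEndLabelling.hasCoxeterQuotient {D : Diagram R} {n : ℕ} {M : CoxeterMatrix (Fin n)}
    {L : R × Fin 4 → Reflection M} (h : D.IsEndLabelling M L) :
    ∃ f : D.knotGroup →* M.Group, D.IsCoxeterQuotient M f ∧
      ∀ e, f (D.meridian (D.endSegment e)) = L e := by
  let F : D.Segment → M.Group := fun s => D.segmentLabel L s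
  have hrel : ∀ g ∈ {g : FreeGroup D.Segment | ∃ a b, D.Wirtinger a b ∧ g = a * b⁻¹},
      FreeGroup.lift F g = 1 := by
    rintro _ ⟨a, b, hab, rfl⟩
    rw [map_mul, map_inv, mul_inv_eq_one]
    cases hab with
    | pos_over r i hi =>
      have hp := D.segmentLabel_pair L r i
      rw [hi, pass_pos_apply, Prod.mk.injEq] at hp
      simp [upMeridian, F, hp]
    | pos_under r i hi =>
      have hp := D.segmentLabel_pair L r i
      rw [hi, pass_pos_apply, Prod.mk.injEq] at hp
      simp [upMeridian, F, hp, conj]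
    | neg_over r i hi =>
      have hp := D.segmentLabel_pair L r i
      rw [hi, pass_neg_apply, Prod.mk.injEq] at hp
      simp [upMeridian, F, hp]
    | neg_under r i hi =>
      have hp := D.segmentLabel_pair L r i
      rw [hi, pass_neg_apply, Prod.mk.injEq] at hp
      simp [upMeridian, F, hp, coe_conj, inv_eq]
    | virt r i side hi =>
      have hp := D.segmentLabel_pair L r i
      rw [hi, pass_virt_apply, Prod.mk.injEq] at hp
      cases side <;> simp [upMeridian, F, hp]
    | glue e =>
      have hF : ∀ s, FreeGroup.lift F (.of s) = D.segmentLabel L s := fun s => by simp [F]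
      have hR : ∀ s, M.toCoxeterSystem.IsReflection (FreeGroup.lift F (.of s)) := fun s => by
        rw [hF]; exact (D.segmentLabel L s).2
      rw [map_inv, D.lift_inMeridian _ _ (hR _), D.lift_inMeridian _ _ (hR _), (hR _).inv, hF, hF,
        h.segmentLabel_endSegment, h.segmentLabel_endSegment, h.glue]
  have hf : ∀ s, PresentedGroup.toGroup hrel (D.meridian s) = D.segmentLabel L s := fun s =>
    PresentedGroup.toGroup.of hrel
  refine ⟨PresentedGroup.toGroup hrel, ⟨?_, fun s => ?_⟩, fun e => ?_⟩
  · rw [← MonoidHom.range_eq_top, eq_top_iff, ← h.generates, Subgroup.closure_le]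
    rintro _ ⟨e, rfl⟩
    exact ⟨D.meridian (D.endSegment e), by rw [hf, h.segmentLabel_endSegment]⟩
  · rw [hf]
    exact (D.segmentLabel L s).2
  · rw [hf, h.segmentLabel_endSegment]

theorem IsCoxeterQuotient.isEndLabelling {D : Diagram R} {n : ℕ} {M : CoxeterMatrix (Fin n)}
    {f : D.knotGroup →* M.Group} (hf : D.IsCoxeterQuotient M f) :
    D.IsEndLabelling M fun e => ⟨f (D.meridian (D.endSegment e)), hf.2 _⟩ := by
  have hrel : ∀ {a b : FreeGroup D.Segment}, D.Wirtinger a b →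
      f (PresentedGroup.mk _ a) = f (PresentedGroup.mk _ b) := by
    intro a b hab
    congr 1
    rw [← mul_inv_eq_one, ← map_inv, ← map_mul]
    exact PresentedGroup.one_of_mem ⟨a, b, hab, rfl⟩
  let L : R × Fin 4 → Reflection M := fun e => ⟨f (D.meridian (D.endSegment e)), hf.2 _⟩
  have hlabel : ∀ (r : R) (i : ℕ) (hi : i < (D.word r).length + 1),
      passWord M ((D.word r).take i) (L (r, 0), L (r, 1)) =
        (⟨f (D.meridian ⟨r, ⟨i, hi⟩, false⟩), hf.2 _⟩,
          ⟨f (D.meridian ⟨r, ⟨i, hi⟩, true⟩), hf.2 _⟩) := by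
    intro r i hi
    induction i with
    | zero => rfl
    | succ i ih =>
      have hi' : i < (D.word r).length := by omega
      rw [passWord_take_succ _ ⟨i, hi'⟩, Equiv.Perm.mul_apply, ih (by omega)]
      cases hc : (D.word r).get ⟨i, hi'⟩ with
      | pos =>
        rw [pass_pos_apply, Prod.mk.injEq, Subtype.ext_iff, Subtype.ext_iff]
        have h₁ := hrel (.pos_under r ⟨i, hi'⟩ hc)
        have h₂ := hrel (.pos_over r ⟨i, hi'⟩ hc)
        simp only [map_mul, map_inv] at h₁
        exact ⟨h₁.symm, h₂.symm⟩
      | neg =>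
        rw [pass_neg_apply, Prod.mk.injEq, Subtype.ext_iff, Subtype.ext_iff, coe_conj]
        have h₁ := hrel (.neg_over r ⟨i, hi'⟩ hc)
        have h₂ := hrel (.neg_under r ⟨i, hi'⟩ hc)
        simp only [map_mul, map_inv] at h₂
        refine ⟨h₁.symm, .trans ?_ h₂.symm⟩
        -- The relation conjugates by an inverse, `conj` does not; for a reflection this is the
        -- same.
        congr 2
        exact (hf.2 _).inv.symm
      | virt =>
        rw [pass_virt_apply, Prod.mk.injEq, Subtype.ext_iff, Subtype.ext_iff]
        have h₁ := hrel (.virt r ⟨i, hi'⟩ true hc)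
        have h₂ := hrel (.virt r ⟨i, hi'⟩ false hc)
        exact ⟨h₁.symm, h₂.symm⟩
  refine ⟨fun e => Subtype.ext ?_, fun r => ?_, ?_⟩
  · have h := hrel (.glue e)
    have h₁ := D.lift_inMeridian (f.comp (PresentedGroup.mk _)) e (hf.2 _)
    have h₂ := D.lift_inMeridian (f.comp (PresentedGroup.mk _)) (D.glue e) (hf.2 _)
    rw [map_inv, map_inv] at h
    rw [MonoidHom.comp_apply] at h₁ h₂
    rw [h₁, h₂] at h
    exact (h.trans (hf.2 _).inv).symm
  · have h := hlabel r (D.word r).length (by omega)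
    rw [List.take_length] at h
    exact h
  · rw [eq_top_iff, ← MonoidHom.range_eq_top.mpr hf.1, MonoidHom.range_eq_map,
      ← PresentedGroup.closure_range_of, MonoidHom.map_closure, Subgroup.closure_le]
    rintro _ ⟨_, ⟨⟨r, ⟨i, hi⟩, side⟩, rfl⟩, rfl⟩
    have h := passWord_mem (S := Subgroup.closure (Set.range fun e => (L e : M.Group)))
      ((D.word r).take i) (x := L (r, 0)) (y := L (r, 1))
      (Subgroup.subset_closure ⟨(r, 0), rfl⟩) (Subgroup.subset_closure ⟨(r, 1), rfl⟩)
    rw [hlabel r i hi] at h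
    cases side
    · exact h.1
    · exact h.2

/-! ### Collapsing even weights -/

/-- The Coxeter matrix in which every even or infinite weight is replaced by `2`. -/
def collapse {B : Type*} [DecidableEq B] (M : CoxeterMatrix B) : CoxeterMatrix B where
  M i j := if Even (M i j) then 2 else M i j
  isSymm := Matrix.IsSymm.ext fun i j => by rw [M.symmetric]
  diagonal i := by simp
  off_diagonal i j h := by
    have := M.off_diagonal i j h
    split_ifs
    · decide
    · exact this

theorem collapse_of_even {B : Type*} [DecidableEq B] {M : CoxeterMatrix B} {i j : B}
    (h : Even (M i j)) : collapse M i j = 2 := if_pos h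

/-- This makes `collapseHom` well defined. The infinite weight `0` is covered, being even and
divisible by `2`. -/
theorem collapse_dvd {B : Type*} [DecidableEq B] (M : CoxeterMatrix B) (i j : B) :
    collapse M i j ∣ M i j := by
  change (if Even (M i j) then 2 else M i j) ∣ M i j
  split_ifs with h
  · exact h.two_dvd
  · exact dvd_rfl

/-- The map onto the Coxeter group in which every even or infinite weight is replaced by `2`. -/
noncomputable def collapseHom {B : Type*} [DecidableEq B] (M : CoxeterMatrix B) :
    M.Group →* (collapse M).Group :=
  M.toCoxeterSystem.lift ⟨(collapse M).simple, fun i j =>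
    orderOf_dvd_iff_pow_eq_one.mp
      ((orderOf_dvd_of_pow_eq_one (simple_mul_simple_pow i j)).trans (collapse_dvd M i j))⟩

theorem collapseHom_simple {B : Type*} [DecidableEq B] (M : CoxeterMatrix B) (i : B) :
    collapseHom M (M.simple i) = (collapse M).simple i :=
  M.toCoxeterSystem.lift_apply_simple _ i

theorem collapseHom_surjective {B : Type*} [DecidableEq B] (M : CoxeterMatrix B) :
    Surjective (collapseHom M) := by
  rw [← MonoidHom.range_eq_top, eq_top_iff,
    ← (collapse M).toCoxeterSystem.subgroup_closure_range_simple, Subgroup.closure_le]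
  rintro _ ⟨i, rfl⟩
  exact ⟨M.simple i, collapseHom_simple M i⟩

theorem isReflection_collapseHom {B : Type*} [DecidableEq B] {M : CoxeterMatrix B} {t : M.Group}
    (h : M.toCoxeterSystem.IsReflection t) :
    (collapse M).toCoxeterSystem.IsReflection (collapseHom M t) := by
  obtain ⟨w, i, rfl⟩ := h
  refine ⟨collapseHom M w, i, ?_⟩
  rw [map_mul, map_mul, map_inv]
  rfl

/-- Two involutions whose product squares to `1` commute. -/
theorem commute_simple_collapse {B : Type*} [DecidableEq B] {M : CoxeterMatrix B} {i j : B}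
    (h : Even (M i j)) : Commute ((collapse M).simple i) ((collapse M).simple j) := by
  have h2 : ((collapse M).simple i * (collapse M).simple j) ^ 2 = 1 := by
    rw [← collapse_of_even h]
    exact simple_mul_simple_pow i j
  have hi := (collapse M).toCoxeterSystem.inv_simple i
  have hj := (collapse M).toCoxeterSystem.inv_simple j
  rw [CoxeterMatrix.toCoxeterSystem_simple] at hi hj
  rw [pow_two, mul_eq_one_iff_eq_inv, mul_inv_rev, hi, hj] at h2
  exact h2

/-! ### Twisted diagrams -/

section Twisted

open Classical in
/-- For a twisted diagram with faces numbered by `e`: the weight of two faces next to the same twist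
region is its number of crossings, all other weights are infinite. -/
noncomputable def twistedMatrix (D : Diagram R) (hD : D.IsTwisted) {B : Type*} (e : D.Face ≃ B) :
    CoxeterMatrix B where
  M i j := if i = j then 1 else
    if h : ∃ r, s(D.leftFace r, D.rightFace r) = s(e.symm i, e.symm j) then
      (D.word h.choose).length else 0
  isSymm := Matrix.IsSymm.ext fun i j => by simp only [eq_comm (a := i), Sym2.eq_swap (a := e.symm i)]
  diagonal i := if_pos rfl
  off_diagonal i j hij := by
    rw [if_neg hij]
    split_ifs with h
    · obtain ⟨c, k, -, hk, hw⟩ := hD.two_le h.choose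
      rw [hw, List.length_replicate]
      omega
    · decide

/-- The chosen twist region is `r` itself by `no_parallel`, and `no_loop` keeps the entry off the
diagonal. -/
theorem twistedMatrix_apply (D : Diagram R) (hD : D.IsTwisted) {B : Type*} (e : D.Face ≃ B)
    (r : R) :
    D.twistedMatrix hD e (e (D.leftFace r)) (e (D.rightFace r)) = (D.word r).length := by
  have h : ∃ r', s(D.leftFace r', D.rightFace r') =
      s(e.symm (e (D.leftFace r)), e.symm (e (D.rightFace r))) := ⟨r, by simp⟩
  have hr : h.choose = r := hD.no_parallel _ _ (h.choose_spec.trans (by simp))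
  have hne : e (D.leftFace r) ≠ e (D.rightFace r) := fun h => hD.no_loop r (e.injective h)
  refine (if_neg hne).trans ?_
  rw [dif_pos h, hr]

/-- The face next to an end of a twist region. -/
def face (D : Diagram R) (x : R × Fin 4) : D.Face := Quot.mk _ x

theorem face_two (D : Diagram R) (r : R) : D.face (r, 2) = D.rightFace r :=
  (Quot.sound (.right r)).symm

theorem face_three (D : Diagram R) (r : R) : D.face (r, 3) = D.leftFace r :=
  (Quot.sound (.left r)).symm

/-- Glued ends share a face, and `k` crossings between faces of weight `k` fix the pair of
generators because `(a * b) ^ k = 1`. Every face contains an end, so all generators occur. -/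
theorem IsTwisted.isEndLabelling {D : Diagram R} (hD : D.IsTwisted) {B : Type*} (e : D.Face ≃ B) :
    D.IsEndLabelling (D.twistedMatrix hD e) fun x => Reflection.simple _ (e (D.face x)) where
  glue x := by
    have : D.face (D.glue x) = D.face x := (Quot.sound (.glue x)).symm
    rw [this]
  passWord r := by
    obtain ⟨c, k, hc, -, hw⟩ := hD.two_le r
    rw [face_two, face_three, hw, passWord_replicate]
    apply pass_pow_apply_eq_self hc
    have h := simple_mul_simple_pow (M := D.twistedMatrix hD e) (e (D.leftFace r))
      (e (D.rightFace r))
    rw [twistedMatrix_apply, hw, List.length_replicate] at h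
    exact h
  generates := by
    rw [eq_top_iff, ← (D.twistedMatrix hD e).toCoxeterSystem.subgroup_closure_range_simple]
    apply Subgroup.closure_mono
    rintro _ ⟨i, rfl⟩
    obtain ⟨x, hx⟩ := Quot.exists_rep (e.symm i)
    refine ⟨x, ?_⟩
    change (D.twistedMatrix hD e).simple (e (Quot.mk _ x)) = (D.twistedMatrix hD e).simple i
    rw [hx, Equiv.apply_symm_apply]

theorem IsTwisted.exists_isCoxeterQuotient [Finite R] {D : Diagram R} (hD : D.IsTwisted) {n : ℕ}
    (hn : Nat.card D.Face = n) :
    ∃ (M : CoxeterMatrix (Fin n)) (f : D.knotGroup →* M.Group), D.IsCoxeterQuotient M f ∧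
      ∀ r, D.IsDouble f r := by
  -- Needed because `Nat.card` would be `0` for infinitely many faces.
  have : Finite D.Face := Quot.finite _
  let e : D.Face ≃ Fin n := Finite.equivFinOfCardEq hn
  obtain ⟨f, hf, hL⟩ := (hD.isEndLabelling e).hasCoxeterQuotient
  refine ⟨_, f, hf, fun r => ⟨e (D.leftFace r), e (D.rightFace r),
    fun h => hD.no_loop r (e.injective h), hL _, ?_, hL _, ?_, fun h => ?_⟩⟩
  · rw [hL, face_three]; rfl
  · rw [hL, face_two]; rfl
  -- The parity condition is automatic: the weight is the number of crossings.
  · rwa [twistedMatrix_apply]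

end Twisted

/-! ### Transfer of a Coxeter quotient -/

theorem IsCoxeterQuotient.hasCoxeterQuotient_of_obtainedFrom {D D' : Diagram R} {n : ℕ}
    {M : CoxeterMatrix (Fin n)} {f : D.knotGroup →* M.Group} (hf : D.IsCoxeterQuotient M f)
    (h : D'.ObtainedFrom D {r | D.IsSingle f r} {r | D.IsDouble f r}) :
    D'.HasCoxeterQuotient n := by
  -- Collapsing once and for all treats all twist regions simultaneously; the other moves work over
  -- any Coxeter matrix.
  have hL := IsCoxeterQuotient.isEndLabelling (f := (collapseHom M).comp f)
    ⟨(collapseHom_surjective M).comp hf.1, fun s => isReflection_collapseHom (hf.2 s)⟩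
  set L : R × Fin 4 → Reflection (collapse M) :=
    fun e => ⟨(collapseHom M).comp f (D.meridian (D.endSegment e)), _⟩
  suffices hL' : D'.IsEndLabelling (collapse M) L by
    obtain ⟨g, hg, -⟩ := hL'.hasCoxeterQuotient
    exact ⟨_, g, hg⟩
  refine ⟨fun e => by rw [h.1, hL.glue], fun r => ?_, hL.generates⟩
  rw [← hL.passWord r]
  obtain ⟨c, k, v, m, a, hc, hw, hmoves, ha, hv⟩ := h.2 r
  by_cases hv0 : v = 0
  -- Without virtualizations the two words act equally on all pairs: the exponent `k + a - 2 * m` is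
  -- `k`.
  · rw [hw, passWord_replicate, hmoves.passWord_eq _ hc hv0, ha]
    congr 1
    push_cast
    rw [add_sub_cancel_right, zpow_natCast]
  rcases hv hv0 with hs | ⟨⟨i, j, -, h0, -, h1, -, heven⟩, hk⟩
  · have h01 : L (r, 0) = L (r, 1) := Subtype.ext (congrArg (collapseHom M) hs)
    rw [h01, passWord_apply_diag, passWord_apply_diag]
  · have hlen : (D.word r).length = k := by rw [hw, List.length_replicate]
    have h0' : (L (r, 0) : (collapse M).Group) = (collapse M).simple i :=
      (congrArg (collapseHom M) h0).trans (collapseHom_simple M i)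
    have h1' : (L (r, 1) : (collapse M).Group) = (collapse M).simple j :=
      (congrArg (collapseHom M) h1).trans (collapseHom_simple M j)
    have hcomm : Commute (L (r, 0) : (collapse M).Group) (L (r, 1)) := by
      rw [h0', h1']
      exact commute_simple_collapse (heven (hlen ▸ hk))
    -- The new length is `k + 2 * m + 2 * q`, so both words are even and fix the commuting pair.
    obtain ⟨q, hq⟩ := hmoves.length_eq
    have hk' : Even (D'.word r).length := by
      rw [hq, ha]
      exact (hk.add (even_two_mul _)).add (even_two_mul _)
    rw [passWord_apply_of_commute _ hcomm, passWord_apply_of_commute _ hcomm, hlen, if_pos hk,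
      if_pos hk']

end Diagram

end VirtualKnot

open VirtualKnot Diagram in
theorem theorem1p2 {R : Type*} [Finite R] (D D' : VirtualKnot.Diagram R) (n : ℕ)
    (single double : Set R)
    (hknot : D.IsKnot) (hplanar : D.IsPlanar) (hclassical : D.IsClassical)
    (hquot : D.GivesCoxeterQuotient n single double)
    (hmoves : D'.ObtainedFrom D single double) :
    D'.IsKnot ∧ D'.IsPlanar ∧ D'.HasCoxeterQuotient n := by
  refine ⟨isKnot_of_parity hknot hmoves.1 fun r => ?_, ?_, ?_⟩
  · obtain ⟨c, k, v, m, a, -, hw, hr, ha, -⟩ := hmoves.2 r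
    obtain ⟨q, hq⟩ := hr.length_eq
    rw [hq, hw, List.length_replicate, ha, Nat.odd_iff, Nat.odd_iff]
    omega
  -- Planarity involves only the gluing, which is unchanged.
  · unfold IsPlanar at *
    rw [hmoves.1]
    exact hplanar
  · cases hquot with
    | labelled M f hf => exact hf.hasCoxeterQuotient_of_obtainedFrom hmoves
    | twisted h hn =>
      obtain ⟨M, f, hf, hdouble⟩ := h.exists_isCoxeterQuotient hn
      refine hf.hasCoxeterQuotient_of_obtainedFrom ⟨hmoves.1, fun r => ?_⟩
      obtain ⟨c, k, v, m, a, hc, hw, hr, ha, hv⟩ := hmoves.2 r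
      refine ⟨c, k, v, m, a, hc, hw, hr, ha, fun hv0 => ?_⟩
      rcases hv hv0 with h | h
      -- A twisted diagram has an empty set `single`.
      · exact absurd h (Set.notMem_empty r)
      · exact Or.inr ⟨hdouble r, h.2⟩
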